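/- Let $\mathcal H$ be a complex Hilbert space and let $A,B$ be positive invertible bounded operators on $\mathcal H$. Let $h$ be a positive continuous function on $(0,\infty)$ with $h(1)=1$ that is operator monotone, i.e. $0<X\le Y$ implies $h(X)\le h(Y)$ for bounded operators $X,Y$ on any infinite-dimensional Hilbert space, where $X>0$ means that $X$ is positive and invertible. Let $$A\,\sigma_h B:=A^{1/2}\,h\bigl(A^{-1/2}BA^{-1/2}\bigr)\,A^{1/2}$$ be the corresponding operator mean. For a positive invertible operator $X$, let $\lambda_{\min}(X)$ be the minimum of the spectrum of $X$, let $\|X\|_\infty$ be its operator norm, and write $\lambda_{\min}^{q}(X)=(\lambda_{\min}(X))^{q}$, $\|X\|_\infty^{q}=(\|X\|_\infty)^q$. (1) If $h$ is power monotone increasing (pmi), i.e. $h(t^p)\ge h(t)^p$ for all $t>0$ and $p\ge1$, then $$A^p\sigma_hB^p\ge\lambda_{\min}^{p-1}(A\sigma_hB)\,(A\sigma_hB)\qquad\text{for all real }p\ge1,$$ $$A^p\sigma_hB^p\le\lambda_{\min}^{p-1}(A\sigma_hB)\,(A\sigma_hB)\qquad\text{for all real }p\text{ with }0<p\le1.$$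 (2) If $h$ is power monotone decreasing (pmd), i.e. $h(t^p)\le h(t)^p$ for all $t>0$ and $p\ge1$, then $$A^p\sigma_hB^p\le\|A\sigma_hB\|_\infty^{p-1}\,(A\sigma_hB)\qquad\text{for all real }p\ge1,$$ $$A^p\sigma_hB^p\ge\|A\sigma_hB\|_\infty^{p-1}\,(A\sigma_hB)\qquad\text{for all real }p\text{ with }0<p\le1.$$ -/

import Mathlib

universe u

/-! Conventions: `H →L[ℂ] H` is the algebra of bounded operators on a complex Hilbert space `H`,
with the Loewner order; `IsStrictlyPositive A` says that `A` is positive and invertible;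
`A ^ p` (for real `p`) and `cfc f A` are given by the continuous functional calculus. -/

/-- A real continuous function `f` on `(0, ∞)` is operator monotone if `0 < A ≤ B` implies
`f(A) ≤ f(B)` for operators on any infinite-dimensional Hilbert space. (The values of `f` outside
`(0, ∞)` play no role.) -/
def IsOperatorMonotone (f : ℝ → ℝ) : Prop :=
  ContinuousOn f (Set.Ioi 0) ∧
    ∀ (K : Type u) [NormedAddCommGroup K] [InnerProductSpace ℂ K] [CompleteSpace K],
      ¬ FiniteDimensional ℂ K →
      ∀ A B : K →L[ℂ] K, IsStrictlyPositive A → A ≤ B → cfc f A ≤ cfc f B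

/-- The class of positive operator monotone functions `h` on `(0, ∞)` with `h(1) = 1`. -/
def OMPlusOne : Set (ℝ → ℝ) :=
  {h | IsOperatorMonotone.{u} h ∧ (∀ t : ℝ, 0 < t → 0 < h t) ∧ h 1 = 1}

/-- Power monotone increasing functions on `(0, ∞)`. -/
def IsPMI (f : ℝ → ℝ) : Prop :=
  ∀ t : ℝ, 0 < t → ∀ p : ℝ, 1 ≤ p → f t ^ p ≤ f (t ^ p)

/-- Power monotone decreasing functions on `(0, ∞)`. -/
def IsPMD (f : ℝ → ℝ) : Prop :=
  ∀ t : ℝ, 0 < t → ∀ p : ℝ, 1 ≤ p → f (t ^ p) ≤ f t ^ p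

section Operators

variable {H : Type*} [NormedAddCommGroup H] [InnerProductSpace ℂ H] [CompleteSpace H]

/-- The operator perspective `P_f(A, B) = B^{1/2} f(B^{-1/2} A B^{-1/2}) B^{1/2}`, meant for
positive invertible `A` and `B`. -/
noncomputable def operatorPerspective (f : ℝ → ℝ) (A B : H →L[ℂ] H) : H →L[ℂ] H :=
  B ^ (1 / 2 : ℝ) * cfc f (B ^ (-(1 / 2) : ℝ) * A * B ^ (-(1 / 2) : ℝ)) * B ^ (1 / 2 : ℝ)

/-- The operator mean `A σ_h B = P_h(B, A) = A^{1/2} h(A^{-1/2} B A^{-1/2}) A^{1/2}` of positive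
invertible operators. -/
noncomputable def operatorMean (h : ℝ → ℝ) (A B : H →L[ℂ] H) : H →L[ℂ] H :=
  operatorPerspective h B A

/-- The minimum of the spectrum of a positive operator (the spectrum is a compact set of reals,
nonempty if `H ≠ 0`, so that the infimum is attained). -/
noncomputable def lambdaMin (X : H →L[ℂ] H) : ℝ :=
  sInf (spectrum ℝ X)

end Operators

/-! Put X = A^{-1/2} B A^{-1/2} and s = p - 1. Since (a X a)^{1+s} can be rewritten with a = A^{1/2}
factored out on both sides, A^p σ B^p = A^{1/2} (A^s σ D(A)) A^{1/2}, where D(A) = X^{1/2} (X^{1/2}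
A X^{1/2})^s X^{1/2} (`operatorMean_rpow_rpow`). A bound c ≤ A σ B says exactly that h(X) ≥ c
A^{-1}, that is, W ≤ A with W = c/h(X).

For 0 ≤ s ≤ 1 both A^s and D(A) are monotone in A by Löwner-Heinz, so joint monotonicity of the mean
(`operatorMean_mono`) allows A to be replaced by W. Everything then commutes with X, and W^s σ D(W)
= W^s h(X^{1+s}), which for pmi h is at least W^s h(X)^{1+s} = c^s h(X). Conjugating by A^{1/2}
gives the claim for 1 ≤ p ≤ 2. For -1 < s ≤ 0 the maps A ↦ A^s, D(A) are antitone and the power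
inequality for h is reversed too. The pmd case is dual, starting from A σ B ≤ c. Exponents p > 2 are
reached by passing to A², B², c² and p/2.

Joint monotonicity rests on Jensen's inequality C* h(X) C ≤ h(C* X C) for contractions C
(`star_mul_cfc_mul_le`), obtained by dilating C to an isometry. -/

open ContinuousLinearMap Filter Topology
open scoped InnerProductSpace

/-! ### Functional calculus under intertwining, and continuity under scaling. -/

section Intertwining

variable {H K : Type*} [NormedAddCommGroup H] [InnerProductSpace ℂ H]
  [NormedAddCommGroup K] [InnerProductSpace ℂ K]

lemma aeval_comp_intertwine {S : K →L[ℂ] K} {T : H →L[ℂ] H} {V : H →L[ℂ] K}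
    (h : S ∘L V = V ∘L T) (q : Polynomial ℝ) :
    Polynomial.aeval S q ∘L V = V ∘L Polynomial.aeval T q := by
  induction q using Polynomial.induction_on' with
  | add p q hp hq => simp only [map_add, add_comp, comp_add, hp, hq]
  | monomial n a =>
    have hn : (S ^ n) ∘L V = V ∘L (T ^ n) := by
      induction n with
      | zero => ext; simp
      | succ n ih =>
        rw [pow_succ, pow_succ', mul_def, mul_def, comp_assoc, h, ← comp_assoc, ih, comp_assoc,
          ← mul_def, ← mul_def, ← pow_succ, ← pow_succ']
    simp only [Polynomial.aeval_monomial, Algebra.algebraMap_eq_smul_one, smul_mul_assoc, one_mul]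
    rw [smul_comp, hn]
    ext; simp

variable [CompleteSpace H] [CompleteSpace K]

lemma exists_pos_smul_one_le {A : H →L[ℂ] H} (hA : IsStrictlyPositive A) :
    ∃ r : ℝ, 0 < r ∧ r • (1 : H →L[ℂ] H) ≤ A := by
  cases subsingleton_or_nontrivial (H →L[ℂ] H) with
  | inl _ => exact ⟨1, one_pos, (Subsingleton.elim _ _).le⟩
  | inr _ =>
  obtain ⟨r, hr, h⟩ := (CFC.exists_pos_algebraMap_le_iff hA.isSelfAdjoint).2
    (fun x hx => hA.spectrum_pos hx)
  exact ⟨r, hr, by rwa [Algebra.algebraMap_eq_smul_one] at h⟩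

lemma isStrictlyPositive_of_smul_one_le {A : H →L[ℂ] H} {r : ℝ} (hr : 0 < r)
    (h : r • (1 : H →L[ℂ] H) ≤ A) : IsStrictlyPositive A :=
  (isStrictlyPositive_one.smul hr).of_le h

lemma adjoint_conj_mono {S T : K →L[ℂ] K} (h : S ≤ T) (V : H →L[ℂ] K) :
    V.adjoint ∘L S ∘L V ≤ V.adjoint ∘L T ∘L V := by
  rw [ContinuousLinearMap.le_def] at h ⊢
  convert h.adjoint_conj V using 1
  ext; simp

lemma conj_adjoint_mono {S T : H →L[ℂ] H} (h : S ≤ T) (V : H →L[ℂ] K) :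
    V ∘L S ∘L V.adjoint ≤ V ∘L T ∘L V.adjoint := by
  simpa using adjoint_conj_mono h V.adjoint

/-- The continuous functional calculus respects intertwining operators. -/
lemma cfc_comp_intertwine {S : K →L[ℂ] K} {T : H →L[ℂ] H} {V : H →L[ℂ] K}
    (hS : IsStrictlyPositive S) (hT : IsStrictlyPositive T) (h : S ∘L V = V ∘L T)
    {f : ℝ → ℝ} (hf : ContinuousOn f (Set.Ioi 0)) :
    cfc f S ∘L V = V ∘L cfc f T := by
  obtain ⟨a, ha, haS⟩ := exists_pos_smul_one_le hS
  obtain ⟨b, hb, hbT⟩ := exists_pos_smul_one_le hT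
  rw [← Algebra.algebraMap_eq_smul_one, algebraMap_le_iff_le_spectrum hS.isSelfAdjoint] at haS
  rw [← Algebra.algebraMap_eq_smul_one, algebraMap_le_iff_le_spectrum hT.isSelfAdjoint] at hbT
  obtain ⟨c, hcS⟩ := (spectrum.isBounded (𝕜 := ℝ) S).bddAbove
  obtain ⟨d, hdT⟩ := (spectrum.isBounded (𝕜 := ℝ) T).bddAbove
  set m := min a b
  set M := max c d
  have hm : 0 < m := lt_min ha hb
  have hIcc : ContinuousOn f (Set.Icc m M) := hf.mono fun x hx => hm.trans_le hx.1
  have hSs : spectrum ℝ S ⊆ Set.Icc m M := fun x hx =>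
    ⟨(min_le_left _ _).trans (haS x hx), (hcS hx).trans (le_max_left _ _)⟩
  have hTs : spectrum ℝ T ⊆ Set.Icc m M := fun x hx =>
    ⟨(min_le_right _ _).trans (hbT x hx), (hdT hx).trans (le_max_right _ _)⟩
  rw [← sub_eq_zero, ← norm_le_zero_iff]
  -- One polynomial approximates f on an interval containing both spectra; its own contributions
  -- cancel by the polynomial case.
  have key : ∀ ε : ℝ, 0 < ε → ‖cfc f S ∘L V - V ∘L cfc f T‖ ≤ ε * (2 * ‖V‖) := by
    intro ε hε
    obtain ⟨q, hq⟩ := exists_polynomial_near_of_continuousOn m M f hIcc ε hε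
    have e1 : ‖cfc f S - cfc q.eval S‖ ≤ ε := by
      rw [← cfc_sub f q.eval S (hIcc.mono hSs) (by fun_prop)]
      refine norm_cfc_le hε.le fun x hx => ?_
      rw [Real.norm_eq_abs, abs_sub_comm]
      exact (hq x (hSs hx)).le
    have e2 : ‖cfc q.eval T - cfc f T‖ ≤ ε := by
      rw [← cfc_sub q.eval f T (by fun_prop) (hIcc.mono hTs)]
      exact norm_cfc_le hε.le fun x hx => (hq x (hTs hx)).le
    have e3 : cfc f S ∘L V - V ∘L cfc f T
        = (cfc f S - cfc q.eval S) ∘L V + V ∘L (cfc q.eval T - cfc f T) := by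
      have := aeval_comp_intertwine h q
      rw [← cfc_polynomial q S hS.isSelfAdjoint, ← cfc_polynomial q T hT.isSelfAdjoint] at this
      rw [sub_comp, comp_sub, this]
      abel
    rw [e3]
    refine (norm_add_le _ _).trans ?_
    have := (opNorm_comp_le (cfc f S - cfc q.eval S) V).trans
      (mul_le_mul_of_nonneg_right e1 (norm_nonneg V))
    have := (opNorm_comp_le V (cfc q.eval T - cfc f T)).trans
      (mul_le_mul_of_nonneg_left e2 (norm_nonneg V))
    linarith
  have hlim : Tendsto (fun ε : ℝ => ε * (2 * ‖V‖)) (𝓝[>] 0) (𝓝 0) := by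
    have : Tendsto (fun ε : ℝ => ε * (2 * ‖V‖)) (𝓝 0) (𝓝 (0 * (2 * ‖V‖))) :=
      (continuous_id.mul continuous_const).tendsto 0
    rw [zero_mul] at this
    exact this.mono_left nhdsWithin_le_nhds
  exact ge_of_tendsto hlim (eventually_mem_nhdsWithin.mono fun ε hε => key ε hε)

/-- Removes the factor 1 + ε that both Jensen arguments lose: f((1 + ε)Y) tends to f(Y) in norm, by
uniform continuity of f on a compact interval. -/
lemma le_cfc_of_forall_le_cfc_smul {f : ℝ → ℝ} (hf : ContinuousOn f (Set.Ioi 0))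
    {Y Z : H →L[ℂ] H} (hY : IsStrictlyPositive Y)
    (h : ∀ ε : ℝ, 0 < ε → Z ≤ cfc f ((1 + ε) • Y)) : Z ≤ cfc f Y := by
  obtain ⟨a, ha, haY⟩ := exists_pos_smul_one_le hY
  rw [← Algebra.algebraMap_eq_smul_one, algebraMap_le_iff_le_spectrum hY.isSelfAdjoint] at haY
  obtain ⟨c, hcY⟩ := (spectrum.isBounded (𝕜 := ℝ) Y).bddAbove
  have huc : UniformContinuousOn f (Set.Icc a (2 * c)) :=
    isCompact_Icc.uniformContinuousOn_of_continuous (hf.mono fun x hx => ha.trans_le hx.1)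
  have hcomp : ∀ ε : ℝ, 0 < ε → cfc f ((1 + ε) • Y) = cfc (fun t => f ((1 + ε) * t)) Y := by
    intro ε hε
    rw [cfc_comp_const_mul (1 + ε) f Y _ hY.isSelfAdjoint]
    refine hf.mono ?_
    rintro _ ⟨x, hx, rfl⟩
    exact mul_pos (by linarith) (hY.spectrum_pos hx)
  have hlim : Tendsto (fun ε : ℝ => cfc (fun t => f ((1 + ε) * t)) Y) (𝓝[>] 0) (𝓝 (cfc f Y)) := by
    apply tendsto_cfc_fun
    · rw [Metric.tendstoUniformlyOn_iff]
      intro η hη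
      obtain ⟨δ, hδ, hδ'⟩ := Metric.uniformContinuousOn_iff.1 huc η hη
      have hsmall : ∀ᶠ ε : ℝ in 𝓝[>] 0, ε * |c| < δ ∧ ε < 1 := by
        have t1 : Tendsto (fun ε : ℝ => ε * |c|) (𝓝 0) (𝓝 (0 * |c|)) :=
          (continuous_id.mul continuous_const).tendsto 0
        rw [zero_mul] at t1
        exact ((t1.eventually_lt_const hδ).and (eventually_lt_nhds one_pos)).filter_mono
          nhdsWithin_le_nhds
      filter_upwards [hsmall, eventually_mem_nhdsWithin] with ε hε hε0 x hx
      have hε0 : 0 < ε := hε0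
      have hax := haY x hx
      have hxc := hcY hx
      refine hδ' x ⟨hax, by linarith⟩ _ ⟨by nlinarith, by nlinarith⟩ ?_
      rw [Real.dist_eq, abs_sub_comm, show (1 + ε) * x - x = ε * x by ring,
        abs_of_nonneg (by nlinarith)]
      exact (mul_le_mul_of_nonneg_left (hxc.trans (le_abs_self c)) hε0.le).trans_lt hε.1
    · filter_upwards [eventually_mem_nhdsWithin] with ε hε0
      have hε0 : 0 < ε := hε0
      refine hf.comp (by fun_prop) fun x hx => ?_
      exact mul_pos (by linarith) (hY.spectrum_pos hx)
  refine ge_of_tendsto hlim (eventually_mem_nhdsWithin.mono fun ε hε => ?_)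
  rw [← hcomp ε hε]
  exact h ε hε

end Intertwining

/-! ### Embedding H into an infinite-dimensional space. -/

section Amplification

variable (H : Type u) [NormedAddCommGroup H] [InnerProductSpace ℂ H]

/-- The Hilbert sum of countably many copies of `H`. -/
abbrev Amplification : Type u := lp (fun _ : ℕ => H) 2

namespace Amplification

/-- The isometric inclusion of the `n`-th summand. -/
noncomputable def incl (n : ℕ) : H →L[ℂ] Amplification H :=
  lp.singleContinuousLinearMap ℂ (fun _ : ℕ => H) 2 n

variable {H}

lemma inner_incl_incl (m n : ℕ) (x y : H) :
    ⟪incl H m x, incl H n y⟫_ℂ = if m = n then ⟪x, y⟫_ℂ else 0 := by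
  rw [incl, incl, lp.singleContinuousLinearMap_apply, lp.singleContinuousLinearMap_apply,
    lp.inner_single_left]
  split_ifs with h
  · subst h; simp
  · simp [h]

lemma not_finiteDimensional [Nontrivial H] : ¬ FiniteDimensional ℂ (Amplification H) := by
  intro hfin
  obtain ⟨v, hv⟩ := exists_norm_eq H zero_le_one
  have ho : Orthonormal ℂ (fun n : ℕ => incl H n v) := by
    rw [orthonormal_iff_ite]
    intro i j
    simp [inner_incl_incl, inner_self_eq_norm_sq_to_K, hv]
  exact not_finite_iff_infinite.2 inferInstance ho.linearIndependent.finite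

variable [CompleteSpace H]

lemma adjoint_incl_comp_incl (n : ℕ) : (incl H n).adjoint ∘L incl H n = 1 := by
  ext x
  refine ext_inner_left ℂ fun y => ?_
  simp [adjoint_inner_right, inner_incl_incl]

lemma adjoint_incl_comp_incl_of_ne {m n : ℕ} (h : m ≠ n) :
    (incl H m).adjoint ∘L incl H n = 0 := by
  ext x
  refine ext_inner_left ℂ fun y => ?_
  simp [adjoint_inner_right, inner_incl_incl, h]

end Amplification

/-- Two orthogonal isometric copies of `H` inside an infinite-dimensional Hilbert space. -/
lemma exists_orthogonal_isometries (H : Type u) [NormedAddCommGroup H] [InnerProductSpace ℂ H]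
    [CompleteSpace H] [Nontrivial H] :
    ∃ (K : Type u) (_ : NormedAddCommGroup K) (_ : InnerProductSpace ℂ K) (_ : CompleteSpace K)
      (J₀ J₁ : H →L[ℂ] K), ¬ FiniteDimensional ℂ K ∧ J₀.adjoint ∘L J₀ = 1 ∧
        J₁.adjoint ∘L J₁ = 1 ∧ J₀.adjoint ∘L J₁ = 0 ∧ J₁.adjoint ∘L J₀ = 0 :=
  ⟨Amplification H, inferInstance, inferInstance, inferInstance, Amplification.incl H 0,
    Amplification.incl H 1, Amplification.not_finiteDimensional,
    Amplification.adjoint_incl_comp_incl 0, Amplification.adjoint_incl_comp_incl 1,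
    Amplification.adjoint_incl_comp_incl_of_ne zero_ne_one,
    Amplification.adjoint_incl_comp_incl_of_ne one_ne_zero⟩

end Amplification

/-! ### Jensen's operator inequality. -/

section Jensen

variable {H K : Type u} [NormedAddCommGroup H] [InnerProductSpace ℂ H] [CompleteSpace H]
  [NormedAddCommGroup K] [InnerProductSpace ℂ K] [CompleteSpace K]

lemma smul_one_le_adjoint_conj {T : K →L[ℂ] K} {V : H →L[ℂ] K} (hV : V.adjoint ∘L V = 1)
    {t : ℝ} (h : t • (1 : K →L[ℂ] K) ≤ T) :
    t • (1 : H →L[ℂ] H) ≤ V.adjoint ∘L T ∘L V := by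
  have := adjoint_conj_mono h V
  rwa [smul_comp, one_def, id_comp, comp_smul, hV] at this

/-- Compression of a positive operator to the range of an isometry and to its complement. -/
lemma le_compression {T : K →L[ℂ] K} (hT : 0 ≤ T) {V : H →L[ℂ] K} {ε : ℝ}
    (hε : 0 < ε) :
    T ≤ V ∘L ((1 + ε) • (V.adjoint ∘L T ∘L V)) ∘L V.adjoint
      + (1 + ε⁻¹) • ((1 - V ∘L V.adjoint) * T * (1 - V ∘L V.adjoint)) := by
  set P : K →L[ℂ] K := V ∘L V.adjoint with hP
  have hPs : star P = P := by rw [star_eq_adjoint, hP, adjoint_comp, adjoint_adjoint]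
  have e1 : V ∘L ((1 + ε) • (V.adjoint ∘L T ∘L V)) ∘L V.adjoint = (1 + ε) • (P * T * P) := by
    ext x; simp [hP]
  rw [e1]
  -- The weights are chosen so that the right side minus T is exactly u T u: the off-diagonal blocks
  -- get coefficient -1 and the diagonal ones ε and 1/ε.
  set u : K →L[ℂ] K := Real.sqrt ε • P - (Real.sqrt ε)⁻¹ • (1 - P) with hu
  have hus : star u = u := by simp [hu, hPs]
  have h0 : 0 ≤ star u * T * u := star_left_conjugate_nonneg hT u
  have hs : Real.sqrt ε * Real.sqrt ε = ε := Real.mul_self_sqrt hε.le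
  have hs0 : Real.sqrt ε ≠ 0 := (Real.sqrt_pos.2 hε).ne'
  have hsi : (Real.sqrt ε)⁻¹ * (Real.sqrt ε)⁻¹ = ε⁻¹ := by rw [← mul_inv, hs]
  rw [hus] at h0
  rw [← sub_nonneg]
  convert h0 using 1
  set Q : K →L[ℂ] K := 1 - P with hQ
  have hT' : T = P * T * P + P * T * Q + Q * T * P + Q * T * Q := by
    rw [hQ]; noncomm_ring
  have hexp : u * T * u = ε • (P * T * P) - P * T * Q - Q * T * P + ε⁻¹ • (Q * T * Q) := by
    rw [hu]
    simp only [sub_mul, mul_sub, smul_sub, smul_mul_assoc, mul_smul_comm, smul_smul, hs, hsi,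
      mul_inv_cancel₀ hs0, inv_mul_cancel₀ hs0, one_smul]
    abel
  rw [hexp]
  nth_rewrite 3 [hT']
  simp only [add_smul, one_smul]
  abel

/-- Jensen's inequality for isometries. -/
lemma adjoint_conj_cfc_le {h : ℝ → ℝ} (hh : IsOperatorMonotone.{u} h)
    (hK : ¬ FiniteDimensional ℂ K) {T : K →L[ℂ] K} (hT : IsStrictlyPositive T)
    {V : H →L[ℂ] K} (hV : V.adjoint ∘L V = 1) :
    V.adjoint ∘L cfc h T ∘L V ≤ cfc h (V.adjoint ∘L T ∘L V) := by
  obtain ⟨t, ht, htT⟩ := exists_pos_smul_one_le hT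
  have hY := isStrictlyPositive_of_smul_one_le ht (smul_one_le_adjoint_conj hV htT)
  refine le_cfc_of_forall_le_cfc_smul hh.1 hY fun ε hε => ?_
  set Y := V.adjoint ∘L T ∘L V with hYdef
  set P : K →L[ℂ] K := V ∘L V.adjoint with hP
  have hPV : P ∘L V = V := by rw [hP, comp_assoc, hV]; rfl
  -- S dominates T and is block diagonal for the range of V, so h(S) compresses exactly to h((1 +
  -- ε)Y).
  set S : K →L[ℂ] K := V ∘L ((1 + ε) • Y) ∘L V.adjoint + (1 + ε⁻¹) • ((1 - P) * T * (1 - P))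
  have hTS : T ≤ S := le_compression hT.nonneg hε
  have hSV : S ∘L V = V ∘L ((1 + ε) • Y) := by
    have h1 : (1 - P) ∘L V = 0 := by rw [sub_comp, hPV, one_def, id_comp, sub_self]
    have h2 : ((1 + ε⁻¹) • ((1 - P) * T * (1 - P))) ∘L V = 0 := by
      rw [smul_comp, mul_def _ (1 - P), comp_assoc _ _ V, h1, comp_zero, smul_zero]
    rw [add_comp, h2, add_zero, comp_assoc, comp_assoc, hV]
    rfl
  have hεY : IsStrictlyPositive ((1 + ε) • Y) := hY.smul (by positivity)
  have key := adjoint_conj_mono (hh.2 K hK T S hT hTS) V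
  rwa [cfc_comp_intertwine (hT.of_le hTS) hεY hSV hh.1, ← comp_assoc _ V, hV, one_def,
    id_comp] at key

/-- The operator acting as `X` on the range of the isometry `J`, and as the scalar `c` on its
orthogonal complement. -/
noncomputable def scalarExtension (J : H →L[ℂ] K) (X : H →L[ℂ] H) (c : ℝ) : K →L[ℂ] K :=
  J ∘L (X - c • 1) ∘L J.adjoint + c • 1

lemma scalarExtension_mono (J : H →L[ℂ] K) {X Y : H →L[ℂ] H} (hXY : X ≤ Y) (c : ℝ) :
    scalarExtension J X c ≤ scalarExtension J Y c :=
  add_le_add_left (conj_adjoint_mono (sub_le_sub_right hXY _) _) _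

lemma isStrictlyPositive_scalarExtension (J : H →L[ℂ] K) {X : H →L[ℂ] H} {c : ℝ} (hc : 0 < c)
    (hX : c • 1 ≤ X) : IsStrictlyPositive (scalarExtension J X c) := by
  refine isStrictlyPositive_of_smul_one_le hc ?_
  have := conj_adjoint_mono (sub_nonneg.2 hX) J
  rw [zero_comp, comp_zero] at this
  exact le_add_of_nonneg_left this

lemma scalarExtension_comp {J : H →L[ℂ] K} (hJ : J.adjoint ∘L J = 1) (X : H →L[ℂ] H) (c : ℝ) :
    scalarExtension J X c ∘L J = J ∘L X := by
  rw [scalarExtension, add_comp, comp_assoc, comp_assoc, hJ]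
  ext; simp

lemma scalarExtension_comp_of_orthogonal {J J' : H →L[ℂ] K} (hJ : J.adjoint ∘L J' = 0)
    (X : H →L[ℂ] H) (c : ℝ) :
    scalarExtension J X c ∘L J' = J' ∘L (c • (1 : H →L[ℂ] H)) := by
  rw [scalarExtension, add_comp, comp_assoc, comp_assoc, hJ]
  ext; simp

/-- Covers finite-dimensional H as well: X and Y are extended by the same scalar to an
infinite-dimensional space, compared there and compressed back. -/
lemma IsOperatorMonotone.cfc_le_cfc {h : ℝ → ℝ} (hh : IsOperatorMonotone.{u} h)
    {X Y : H →L[ℂ] H} (hX : IsStrictlyPositive X) (hXY : X ≤ Y) : cfc h X ≤ cfc h Y := by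
  cases subsingleton_or_nontrivial H with
  | inl _ => exact (Subsingleton.elim _ _).le
  | inr _ =>
  obtain ⟨c, hc, hcX⟩ := exists_pos_smul_one_le hX
  obtain ⟨K, _, _, _, J, -, hK, hJ, -⟩ := exists_orthogonal_isometries H
  have hX' := isStrictlyPositive_scalarExtension J hc hcX
  have hY' := isStrictlyPositive_scalarExtension J hc (hcX.trans hXY)
  have key := adjoint_conj_mono
    (hh.2 K hK _ _ hX' (scalarExtension_mono J hXY c)) J
  rwa [cfc_comp_intertwine hX' hX (scalarExtension_comp hJ X c) hh.1,
    cfc_comp_intertwine hY' (hX.of_le hXY) (scalarExtension_comp hJ Y c) hh.1, ← comp_assoc,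
    ← comp_assoc, hJ, one_def, id_comp, id_comp] at key

/-- Jensen's inequality for contractions. -/
lemma star_mul_cfc_mul_le {h : ℝ → ℝ} (hh : IsOperatorMonotone.{u} h)
    (hpos : ∀ t : ℝ, 0 < t → 0 < h t) {X C : H →L[ℂ] H} (hX : IsStrictlyPositive X)
    (hC : star C * C ≤ 1) (hY : IsStrictlyPositive (star C * X * C)) :
    star C * cfc h X * C ≤ cfc h (star C * X * C) := by
  cases subsingleton_or_nontrivial H with
  | inl _ => exact (Subsingleton.elim _ _).le
  | inr _ =>
  set Y := star C * X * C with hYdef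
  refine le_cfc_of_forall_le_cfc_smul hh.1 hY fun ε hε => ?_
  obtain ⟨x, hx, hxX⟩ := exists_pos_smul_one_le hX
  obtain ⟨y, hy, hyY⟩ := exists_pos_smul_one_le hY
  -- c ≤ x keeps the extension of X strictly positive; c ≤ ε y lets the surplus c(1 - C*C) be
  -- absorbed into ε Y.
  set c := min x (ε * y)
  have hc : 0 < c := lt_min hx (mul_pos hε hy)
  have hone : (0 : H →L[ℂ] H) ≤ 1 := zero_le_one
  have hcX : c • (1 : H →L[ℂ] H) ≤ X :=
    (smul_le_smul_of_nonneg_right (min_le_left _ _) hone).trans hxX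
  have hD : 0 ≤ 1 - star C * C := sub_nonneg.2 hC
  set E := CFC.sqrt (1 - star C * C)
  have hEs : E.adjoint = E := (CFC.sqrt_nonneg (1 - star C * C)).isSelfAdjoint.star_eq
  have hEE : E ∘L E = 1 - star C * C := CFC.sqrt_mul_sqrt_self _ hD
  obtain ⟨K, _, _, _, J₀, J₁, hK, hJ, h11, h01, h10⟩ := exists_orthogonal_isometries H
  -- The column with entries C and (1 - C*C)^{1/2} is an isometry dilating the contraction C.
  set V : H →L[ℂ] K := J₀ ∘L C + J₁ ∘L E
  have hVa : V.adjoint = star C ∘L (J₀).adjoint + E ∘L (J₁).adjoint := by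
    rw [map_add, adjoint_comp, adjoint_comp, hEs]; rfl
  have hblock : ∀ F G : H →L[ℂ] H, V.adjoint ∘L (J₀ ∘L F + J₁ ∘L G)
      = star C * F + E * G := by
    intro F G
    rw [hVa, add_comp, comp_add, comp_add]
    simp only [comp_assoc]
    rw [← comp_assoc J₀.adjoint J₀, ← comp_assoc J₀.adjoint J₁, ← comp_assoc J₁.adjoint J₀,
      ← comp_assoc J₁.adjoint J₁, hJ, h01, h10, h11]
    ext; simp
  have hV : V.adjoint ∘L V = 1 := by
    rw [hblock C E, mul_def E, hEE]; abel
  set T := scalarExtension J₀ X c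
  have hT : IsStrictlyPositive T := isStrictlyPositive_scalarExtension J₀ hc hcX
  have hTV : V.adjoint ∘L T ∘L V = Y + c • (1 - star C * C) := by
    have : T ∘L V = J₀ ∘L (X * C) + J₁ ∘L (c • E) := by
      rw [comp_add, ← comp_assoc, ← comp_assoc, scalarExtension_comp hJ, scalarExtension_comp_of_orthogonal h01]
      ext; simp
    rw [this, hblock, mul_smul_comm, mul_def E, hEE, hYdef, mul_assoc]
  have hc1 : IsStrictlyPositive (c • (1 : H →L[ℂ] H)) := isStrictlyPositive_one.smul hc
  have hhTV : V.adjoint ∘L cfc h T ∘L V = star C * cfc h X * C + h c • (1 - star C * C) := by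
    have : cfc h T ∘L V = J₀ ∘L (cfc h X * C) + J₁ ∘L (h c • E) := by
      rw [comp_add, ← comp_assoc, ← comp_assoc,
        cfc_comp_intertwine hT hX (scalarExtension_comp hJ X c) hh.1,
        cfc_comp_intertwine hT hc1 (scalarExtension_comp_of_orthogonal h01 X c) hh.1,
        ← Algebra.algebraMap_eq_smul_one, cfc_algebraMap, Algebra.algebraMap_eq_smul_one]
      ext; simp
    rw [this, hblock, mul_smul_comm, mul_def E, hEE, mul_assoc]
  have hle : Y + c • (1 - star C * C) ≤ (1 + ε) • Y := by
    rw [add_smul, one_smul]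
    refine add_le_add_right ?_ Y
    calc c • (1 - star C * C) ≤ c • (1 : H →L[ℂ] H) :=
          smul_le_smul_of_nonneg_left (sub_le_self _ (star_mul_self_nonneg C)) hc.le
      _ ≤ (ε * y) • (1 : H →L[ℂ] H) := smul_le_smul_of_nonneg_right (min_le_right _ _) hone
      _ = ε • (y • (1 : H →L[ℂ] H)) := mul_smul _ _ _
      _ ≤ ε • Y := smul_le_smul_of_nonneg_left hyY hε.le
  have hYc : IsStrictlyPositive (Y + c • (1 - star C * C)) :=
    hY.add_nonneg (smul_nonneg hc.le hD)
  calc star C * cfc h X * C ≤ star C * cfc h X * C + h c • (1 - star C * C) :=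
        le_add_of_nonneg_right (smul_nonneg (hpos c hc).le hD)
    _ = V.adjoint ∘L cfc h T ∘L V := hhTV.symm
    _ ≤ cfc h (V.adjoint ∘L T ∘L V) := adjoint_conj_cfc_le hh hK hT hV
    _ = cfc h (Y + c • (1 - star C * C)) := by rw [hTV]
    _ ≤ cfc h ((1 + ε) • Y) := hh.cfc_le_cfc hYc hle

end Jensen

/-! ### Real powers and positivity. -/

section Powers

variable {H : Type u} [NormedAddCommGroup H] [InnerProductSpace ℂ H] [CompleteSpace H]

lemma IsStrictlyPositive.rpow_rpow {A : H →L[ℂ] H} (hA : IsStrictlyPositive A) (x y : ℝ) :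
    (A ^ x) ^ y = A ^ (x * y) := by
  rcases eq_or_ne x 0 with rfl | hx
  · rw [zero_mul, CFC.rpow_zero A hA.nonneg, CFC.one_rpow]
  · exact CFC.rpow_rpow A x y hx hA

lemma IsStrictlyPositive.rpow_half_mul_self {A : H →L[ℂ] H} (hA : IsStrictlyPositive A) :
    A ^ (1 / 2 : ℝ) * A ^ (1 / 2 : ℝ) = A := by
  rw [← CFC.rpow_add hA.isUnit]
  norm_num
  exact CFC.rpow_one A hA.nonneg

lemma rpow_isSelfAdjoint (A : H →L[ℂ] H) (x : ℝ) : IsSelfAdjoint (A ^ x) :=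
  CFC.rpow_nonneg.isSelfAdjoint

/-- Löwner-Heinz for the exponent -s, followed by operator antitonicity of inversion. -/
lemma rpow_le_rpow_of_nonpos {A B : H →L[ℂ] H} (hA : IsStrictlyPositive A) (hAB : A ≤ B) {s : ℝ}
    (hs : s ∈ Set.Icc (-1 : ℝ) 0) : B ^ s ≤ A ^ s := by
  have h1 : A ^ (-s) ≤ B ^ (-s) := CFC.rpow_le_rpow ⟨by linarith [hs.2], by linarith [hs.1]⟩ hAB
  have h2 := CStarAlgebra.rpow_neg_one_le_rpow_neg_one h1 (IsStrictlyPositive.rpow A (-s) hA)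
  rwa [hA.rpow_rpow, (hA.of_le hAB).rpow_rpow, mul_neg_one, neg_neg] at h2

lemma IsStrictlyPositive.rpow_conj {A B : H →L[ℂ] H} (hA : IsStrictlyPositive A)
    (hB : IsStrictlyPositive B) (s : ℝ) : IsStrictlyPositive (A ^ s * B * A ^ s) :=
  IsStrictlyPositive.conjugate_of_isUnit_of_isSelfAdjoint _ _
    (IsStrictlyPositive.rpow A s hA).isUnit (rpow_isSelfAdjoint A s) hB

lemma IsStrictlyPositive.continuousOn_spectrum {f : ℝ → ℝ} (hf : ContinuousOn f (Set.Ioi 0))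
    {X : H →L[ℂ] H} (hX : IsStrictlyPositive X) : ContinuousOn f (spectrum ℝ X) :=
  hf.mono fun _ hx => hX.spectrum_pos hx

lemma continuousOn_rpow_Ioi (s : ℝ) : ContinuousOn (fun t : ℝ => t ^ s) (Set.Ioi 0) :=
  continuousOn_id.rpow_const fun _ hx => Or.inl (ne_of_gt hx)

lemma IsStrictlyPositive.cfc_of_pos {f : ℝ → ℝ} (hf : ContinuousOn f (Set.Ioi 0))
    (hpos : ∀ t : ℝ, 0 < t → 0 < f t) {X : H →L[ℂ] H} (hX : IsStrictlyPositive X) :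
    IsStrictlyPositive (cfc f X) :=
  (cfc_isStrictlyPositive_iff f X (hX.continuousOn_spectrum hf) hX.isSelfAdjoint).2
    fun t ht => hpos t (hX.spectrum_pos ht)

lemma cfc_mul_cfc_mul_cfc {f g : ℝ → ℝ} {X : H →L[ℂ] H} (hf : ContinuousOn f (spectrum ℝ X))
    (hg : ContinuousOn g (spectrum ℝ X)) :
    cfc f X * cfc g X * cfc f X = cfc (fun t => f t * f t * g t) X := by
  rw [← cfc_mul f g X hf hg, ← cfc_mul (fun t => f t * g t) f X (hf.mul hg) hf]
  exact cfc_congr fun t _ => by ring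

end Powers

/-! ### Monotonicity of means and the formula for means of powers. -/

section Mean

variable {H : Type u} [NormedAddCommGroup H] [InnerProductSpace ℂ H] [CompleteSpace H]

lemma operatorMean_def (h : ℝ → ℝ) (A B : H →L[ℂ] H) :
    operatorMean h A B = A ^ (1 / 2 : ℝ)
      * cfc h (A ^ (-(1 / 2) : ℝ) * B * A ^ (-(1 / 2) : ℝ)) * A ^ (1 / 2 : ℝ) := rfl

lemma isStrictlyPositive_operatorMean {h : ℝ → ℝ} (hc : ContinuousOn h (Set.Ioi 0))
    (hpos : ∀ t : ℝ, 0 < t → 0 < h t) {A B : H →L[ℂ] H} (hA : IsStrictlyPositive A)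
    (hB : IsStrictlyPositive B) : IsStrictlyPositive (operatorMean h A B) :=
  hA.rpow_conj ((hA.rpow_conj hB _).cfc_of_pos hc hpos) _

/-- Operator means are jointly monotone. -/
lemma operatorMean_mono {h : ℝ → ℝ} (hh : IsOperatorMonotone.{u} h)
    (hpos : ∀ t : ℝ, 0 < t → 0 < h t) {A₁ A₂ B₁ B₂ : H →L[ℂ] H} (hA₁ : IsStrictlyPositive A₁)
    (hB₁ : IsStrictlyPositive B₁) (hA : A₁ ≤ A₂) (hB : B₁ ≤ B₂) :
    operatorMean h A₁ B₁ ≤ operatorMean h A₂ B₂ := by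
  have hA₂ := hA₁.of_le hA
  trans operatorMean h A₂ B₁
  · set a := A₁ ^ (1 / 2 : ℝ) with ha
    set a' := A₁ ^ (-(1 / 2) : ℝ) with ha'
    set b := A₂ ^ (1 / 2 : ℝ) with hb
    set b' := A₂ ^ (-(1 / 2) : ℝ) with hb'
    have haa' : a * a' = 1 := CFC.rpow_mul_rpow_neg _ hA₁
    have ha'a : a' * a = 1 := CFC.rpow_neg_mul_rpow _ hA₁
    have hbb' : b * b' = 1 := CFC.rpow_mul_rpow_neg _ hA₂
    have hb'b : b' * b = 1 := CFC.rpow_neg_mul_rpow _ hA₂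
    have hbs : IsSelfAdjoint b := rpow_isSelfAdjoint _ _
    have hb's : IsSelfAdjoint b' := rpow_isSelfAdjoint _ _
    have hCs : star (a * b') = b' * a := by
      rw [star_mul, hb's.star_eq, (rpow_isSelfAdjoint A₁ _).star_eq]
    -- A₁ ≤ A₂ makes A₁^{1/2} A₂^{-1/2} a contraction; conjugation by it exchanges the normalization
    -- by A₁ for that by A₂.
    have hC : star (a * b') * (a * b') ≤ 1 := by
      have : star (a * b') * (a * b') = b' * A₁ * b' := by
        rw [hCs, ← hA₁.rpow_half_mul_self]; simp only [mul_assoc]; rfl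
      rw [this, ← CFC.conjugate_rpow_neg_one_half A₂ hA₂]
      exact hb's.conjugate_le_conjugate hA
    have hX := hA₁.rpow_conj hB₁ (-(1 / 2))
    have hY := hA₂.rpow_conj hB₁ (-(1 / 2))
    have hconj : star (a * b') * (a' * B₁ * a') * (a * b') = b' * B₁ * b' := by
      rw [hCs]
      calc b' * a * (a' * B₁ * a') * (a * b') = b' * (a * a') * B₁ * (a' * a) * b' := by
            simp only [mul_assoc]
        _ = b' * B₁ * b' := by rw [haa', ha'a, mul_one, mul_one]
    have key := star_mul_cfc_mul_le hh hpos hX hC (by rw [hconj]; exact hY)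
    rw [hconj, hCs] at key
    have key2 := hbs.conjugate_le_conjugate key
    calc operatorMean h A₁ B₁ = b * (b' * a * cfc h (a' * B₁ * a') * (a * b')) * b := by
          rw [operatorMean_def]
          calc a * cfc h (a' * B₁ * a') * a
              = (b * b') * a * cfc h (a' * B₁ * a') * a * (b' * b) := by
                rw [hbb', hb'b, one_mul, mul_one]
            _ = _ := by simp only [mul_assoc]
      _ ≤ operatorMean h A₂ B₁ := key2
  · refine (rpow_isSelfAdjoint A₂ _).conjugate_le_conjugate ?_
    exact hh.cfc_le_cfc (hA₂.rpow_conj hB₁ _)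
      ((rpow_isSelfAdjoint A₂ _).conjugate_le_conjugate hB)

lemma operatorMean_cfc_cfc {h : ℝ → ℝ} (hc : ContinuousOn h (Set.Ioi 0))
    {g k : ℝ → ℝ} (hg : ContinuousOn g (Set.Ioi 0)) (hk : ContinuousOn k (Set.Ioi 0))
    (hg0 : ∀ t : ℝ, 0 < t → 0 < g t) (hk0 : ∀ t : ℝ, 0 < t → 0 < k t)
    {X : H →L[ℂ] H} (hX : IsStrictlyPositive X) :
    operatorMean h (cfc g X) (cfc k X) = cfc (fun t => g t * h (k t / g t)) X := by
  have hpow : ∀ s : ℝ, cfc g X ^ s = cfc (fun t => g t ^ s) X := fun s =>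
    CFC.cfc_rpow (fun t ht => hg0 t (hX.spectrum_pos ht)) (hX.continuousOn_spectrum hg)
      hX.isSelfAdjoint
  have hgs : ∀ s : ℝ, ContinuousOn (fun t => g t ^ s) (spectrum ℝ X) := fun s =>
    hX.continuousOn_spectrum (hg.rpow_const fun t ht => Or.inl (hg0 t ht).ne')
  have hkX := hX.continuousOn_spectrum hk
  have hdiv : ContinuousOn (fun t => k t / g t) (spectrum ℝ X) :=
    hX.continuousOn_spectrum (hk.div hg fun t ht => (hg0 t ht).ne')
  have himg : ContinuousOn h ((fun t => k t / g t) '' spectrum ℝ X) := by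
    refine hc.mono ?_
    rintro _ ⟨t, ht, rfl⟩
    exact div_pos (hk0 t (hX.spectrum_pos ht)) (hg0 t (hX.spectrum_pos ht))
  have hcomp : ContinuousOn (fun t => h (k t / g t)) (spectrum ℝ X) :=
    himg.comp hdiv (Set.mapsTo_image _ _)
  rw [operatorMean_def, hpow, hpow, cfc_mul_cfc_mul_cfc (hgs _) hkX]
  have e1 : cfc (fun t => g t ^ (-(1 / 2) : ℝ) * g t ^ (-(1 / 2) : ℝ) * k t) X
      = cfc (fun t => k t / g t) X := by
    refine cfc_congr fun t ht => ?_
    have := hg0 t (hX.spectrum_pos ht)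
    have e : (-(1 / 2) + -(1 / 2) : ℝ) = -1 := by norm_num
    simp only [← Real.rpow_add this]
    rw [e, Real.rpow_neg_one, div_eq_inv_mul]
  rw [e1, ← cfc_comp' h _ X himg hdiv hX.isSelfAdjoint, cfc_mul_cfc_mul_cfc (hgs _) hcomp]
  refine cfc_congr fun t ht => ?_
  have := hg0 t (hX.spectrum_pos ht)
  simp only [← Real.rpow_add this, add_halves, Real.rpow_one]

/-- The operator `X^{1/2} (X^{1/2} A X^{1/2})^s X^{1/2}`. -/
noncomputable def sandwichPow (s : ℝ) (X A : H →L[ℂ] H) : H →L[ℂ] H :=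
  X ^ (1 / 2 : ℝ) * (X ^ (1 / 2 : ℝ) * A * X ^ (1 / 2 : ℝ)) ^ s * X ^ (1 / 2 : ℝ)

lemma isStrictlyPositive_sandwichPow (s : ℝ) {X A : H →L[ℂ] H} (hX : IsStrictlyPositive X)
    (hA : IsStrictlyPositive A) : IsStrictlyPositive (sandwichPow s X A) :=
  hX.rpow_conj (IsStrictlyPositive.rpow _ s (hX.rpow_conj hA _)) _

lemma sandwichPow_mono {s : ℝ} (hs : s ∈ Set.Icc (0 : ℝ) 1) (X : H →L[ℂ] H) {A B : H →L[ℂ] H}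
    (hAB : A ≤ B) : sandwichPow s X A ≤ sandwichPow s X B :=
  (rpow_isSelfAdjoint X _).conjugate_le_conjugate
    (CFC.rpow_le_rpow hs ((rpow_isSelfAdjoint X _).conjugate_le_conjugate hAB))

lemma sandwichPow_anti {s : ℝ} (hs : s ∈ Set.Icc (-1 : ℝ) 0) {X A B : H →L[ℂ] H}
    (hX : IsStrictlyPositive X) (hA : IsStrictlyPositive A) (hAB : A ≤ B) :
    sandwichPow s X B ≤ sandwichPow s X A :=
  (rpow_isSelfAdjoint X _).conjugate_le_conjugate
    (rpow_le_rpow_of_nonpos (hX.rpow_conj hA _)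
      ((rpow_isSelfAdjoint X _).conjugate_le_conjugate hAB) hs)

/-- With Z = A^{1/2} X^{1/2}, the two bases are Z Z* and Z* Z. Hence Z intertwines them, and their
s-th powers as well. -/
lemma rpow_one_add_conj {A X : H →L[ℂ] H} (hA : IsStrictlyPositive A)
    (hX : IsStrictlyPositive X) (s : ℝ) :
    (A ^ (1 / 2 : ℝ) * X * A ^ (1 / 2 : ℝ)) ^ (1 + s)
      = A ^ (1 / 2 : ℝ) * sandwichPow s X A * A ^ (1 / 2 : ℝ) := by
  set a := A ^ (1 / 2 : ℝ)
  set x := X ^ (1 / 2 : ℝ) with hx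
  have haa : a * a = A := hA.rpow_half_mul_self
  have hxx : x * x = X := hX.rpow_half_mul_self
  have hB : IsStrictlyPositive (a * X * a) := hA.rpow_conj hX _
  have hC : IsStrictlyPositive (x * A * x) := hX.rpow_conj hA _
  have hint : (a * X * a) ∘L (a * x) = (a * x) ∘L (x * A * x) := by
    rw [← mul_def, ← mul_def, ← haa, ← hxx]; simp only [mul_assoc]
  have key := cfc_comp_intertwine hB hC hint (continuousOn_rpow_Ioi s)
  rw [← CFC.rpow_eq_cfc_real hB.nonneg, ← CFC.rpow_eq_cfc_real hC.nonneg, ← mul_def,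
    ← mul_def] at key
  calc (a * X * a) ^ (1 + s) = (a * X * a) ^ s * (a * X * a) := by
        rw [add_comm, CFC.rpow_add hB.isUnit, CFC.rpow_one _ hB.nonneg]
    _ = ((a * X * a) ^ s * (a * x)) * (x * a) := by
        nth_rewrite 2 [← hxx]; simp only [mul_assoc]
    _ = a * sandwichPow s X A * a := by rw [key, sandwichPow]; simp only [mul_assoc]; rfl

/-- Powers of both arguments of a mean, expressed through `X = A^{-1/2} B A^{-1/2}`. -/
lemma operatorMean_rpow_rpow (h : ℝ → ℝ) {A B : H →L[ℂ] H} (hA : IsStrictlyPositive A)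
    (hB : IsStrictlyPositive B) (s : ℝ) :
    operatorMean h (A ^ (1 + s)) (B ^ (1 + s)) = A ^ (1 / 2 : ℝ) * operatorMean h (A ^ s)
      (sandwichPow s (A ^ (-(1 / 2) : ℝ) * B * A ^ (-(1 / 2) : ℝ)) A) * A ^ (1 / 2 : ℝ) := by
  set X := A ^ (-(1 / 2) : ℝ) * B * A ^ (-(1 / 2) : ℝ) with hXdef
  have hX : IsStrictlyPositive X := hA.rpow_conj hB _
  have h1 : A ^ (1 / 2 : ℝ) * A ^ (-(1 / 2) : ℝ) = 1 := CFC.rpow_mul_rpow_neg _ hA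
  have h2 : A ^ (-(1 / 2) : ℝ) * A ^ (1 / 2 : ℝ) = 1 := CFC.rpow_neg_mul_rpow _ hA
  have hBX : B = A ^ (1 / 2 : ℝ) * X * A ^ (1 / 2 : ℝ) := by
    calc B = (A ^ (1 / 2 : ℝ) * A ^ (-(1 / 2) : ℝ)) * B
          * (A ^ (-(1 / 2) : ℝ) * A ^ (1 / 2 : ℝ)) := by rw [h1, h2, one_mul, mul_one]
      _ = _ := by rw [hXdef]; simp only [mul_assoc]
  have hBp : B ^ (1 + s) = A ^ (1 / 2 : ℝ) * sandwichPow s X A * A ^ (1 / 2 : ℝ) := by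
    nth_rewrite 1 [hBX]
    exact rpow_one_add_conj hA hX s
  rw [hBp, operatorMean_def, operatorMean_def]
  simp only [hA.rpow_rpow]
  set D := sandwichPow s X A
  have e1 : A ^ ((1 + s) * (1 / 2)) = A ^ (1 / 2 : ℝ) * A ^ (s * (1 / 2)) := by
    rw [← CFC.rpow_add hA.isUnit]; congr 1; ring
  have e1' : A ^ ((1 + s) * (1 / 2)) = A ^ (s * (1 / 2)) * A ^ (1 / 2 : ℝ) := by
    rw [← CFC.rpow_add hA.isUnit]; congr 1; ring
  have e2 : A ^ ((1 + s) * -(1 / 2)) = A ^ (s * -(1 / 2)) * A ^ (-(1 / 2) : ℝ) := by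
    rw [← CFC.rpow_add hA.isUnit]; congr 1; ring
  have e2' : A ^ ((1 + s) * -(1 / 2)) = A ^ (-(1 / 2) : ℝ) * A ^ (s * -(1 / 2)) := by
    rw [← CFC.rpow_add hA.isUnit]; congr 1; ring
  have e3 : A ^ ((1 + s) * -(1 / 2)) * (A ^ (1 / 2 : ℝ) * D * A ^ (1 / 2 : ℝ))
      * A ^ ((1 + s) * -(1 / 2)) = A ^ (s * -(1 / 2)) * D * A ^ (s * -(1 / 2)) := by
    nth_rewrite 1 [e2]
    rw [e2']
    calc _ = A ^ (s * -(1 / 2)) * (A ^ (-(1 / 2) : ℝ) * A ^ (1 / 2 : ℝ)) * D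
          * (A ^ (1 / 2 : ℝ) * A ^ (-(1 / 2) : ℝ)) * A ^ (s * -(1 / 2)) := by
          simp only [mul_assoc]
      _ = _ := by rw [h1, h2, mul_one, mul_one]
  rw [e3]
  nth_rewrite 1 [e1]
  rw [e1']
  simp only [mul_assoc]

lemma sandwichPow_cfc {w : ℝ → ℝ} (hw : ContinuousOn w (Set.Ioi 0))
    (hw0 : ∀ t : ℝ, 0 < t → 0 < w t) {X : H →L[ℂ] H} (hX : IsStrictlyPositive X) (s : ℝ) :
    sandwichPow s X (cfc w X) = cfc (fun t => t * (t * w t) ^ s) X := by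
  have hwX := hX.continuousOn_spectrum hw
  have hr := hX.continuousOn_spectrum (continuousOn_rpow_Ioi (1 / 2))
  have hhalf : ∀ t ∈ spectrum ℝ X, t ^ (1 / 2 : ℝ) * t ^ (1 / 2 : ℝ) = t := fun t ht => by
    rw [← Real.rpow_add (hX.spectrum_pos ht)]; norm_num
  have htw : ContinuousOn (fun t => t * w t) (spectrum ℝ X) := continuousOn_id.mul hwX
  have htw0 : ∀ t ∈ spectrum ℝ X, 0 < t * w t := fun t ht =>
    mul_pos (hX.spectrum_pos ht) (hw0 t (hX.spectrum_pos ht))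
  have htws : ContinuousOn (fun t => (t * w t) ^ s) (spectrum ℝ X) :=
    htw.rpow_const fun t ht => Or.inl (htw0 t ht).ne'
  rw [sandwichPow, CFC.rpow_eq_cfc_real (a := X) hX.nonneg, cfc_mul_cfc_mul_cfc hr hwX]
  have e1 : cfc (fun t : ℝ => t ^ (1 / 2 : ℝ) * t ^ (1 / 2 : ℝ) * w t) X
      = cfc (fun t => t * w t) X := by
    refine cfc_congr fun t ht => ?_
    linear_combination w t * hhalf t ht
  rw [e1, CFC.cfc_rpow htw0 htw hX.isSelfAdjoint, cfc_mul_cfc_mul_cfc hr htws]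
  refine cfc_congr fun t ht => ?_
  linear_combination (t * w t) ^ s * hhalf t ht

/-- All operators are functions of X, so the mean is computed pointwise. The weight cancels inside
h: t (t w)^s / w^s = t^{1+s}. -/
lemma operatorMean_cfc_rpow_sandwichPow {h : ℝ → ℝ} (hc : ContinuousOn h (Set.Ioi 0))
    {w : ℝ → ℝ} (hw : ContinuousOn w (Set.Ioi 0)) (hw0 : ∀ t : ℝ, 0 < t → 0 < w t)
    {X : H →L[ℂ] H} (hX : IsStrictlyPositive X) (s : ℝ) :
    operatorMean h (cfc w X ^ s) (sandwichPow s X (cfc w X))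
      = cfc (fun t => w t ^ s * h (t ^ (1 + s))) X := by
  have hg : ContinuousOn (fun t => w t ^ s) (Set.Ioi 0) :=
    hw.rpow_const fun t ht => Or.inl (hw0 t ht).ne'
  have htw : ContinuousOn (fun t => t * w t) (Set.Ioi 0) := continuousOn_id.mul hw
  have hk : ContinuousOn (fun t => t * (t * w t) ^ s) (Set.Ioi 0) :=
    continuousOn_id.mul (htw.rpow_const fun t ht => Or.inl (mul_pos ht (hw0 t ht)).ne')
  rw [sandwichPow_cfc hw hw0 hX, CFC.cfc_rpow (fun t ht => hw0 t (hX.spectrum_pos ht))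
    (hX.continuousOn_spectrum hw) hX.isSelfAdjoint, operatorMean_cfc_cfc hc hg hk
    (fun t ht => Real.rpow_pos_of_pos (hw0 t ht) s)
    (fun t ht => mul_pos ht (Real.rpow_pos_of_pos (mul_pos ht (hw0 t ht)) s)) hX]
  refine cfc_congr fun t ht => ?_
  have ht0 : 0 < t := hX.spectrum_pos ht
  have hws := (Real.rpow_pos_of_pos (hw0 t ht0) s).ne'
  have : t * (t * w t) ^ s / w t ^ s = t ^ (1 + s) := by
    rw [Real.mul_rpow ht0.le (hw0 t ht0).le, Real.rpow_add ht0, Real.rpow_one]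
    field_simp
  simp only [this]

end Mean

/-! ### The Ando-Hiai type inequalities. -/

section AndoHiai

/-- The defining inequality at the point t^p with exponent 1/p, raised to the power p. -/
lemma IsPMI.le_rpow {h : ℝ → ℝ} (hm : IsPMI h) (hpos : ∀ t : ℝ, 0 < t → 0 < h t) {t p : ℝ}
    (ht : 0 < t) (hp : 0 < p) (hp1 : p ≤ 1) : h (t ^ p) ≤ h t ^ p := by
  have htp := Real.rpow_pos_of_pos ht p
  have h1 := hm (t ^ p) htp p⁻¹ ((one_le_inv₀ hp).2 hp1)
  rw [Real.rpow_rpow_inv ht.le hp.ne'] at h1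
  have h2 := Real.rpow_le_rpow (Real.rpow_nonneg (hpos _ htp).le _) h1 hp.le
  rwa [Real.rpow_inv_rpow (hpos _ htp).le hp.ne'] at h2

lemma IsPMD.rpow_le {h : ℝ → ℝ} (hm : IsPMD h) (hpos : ∀ t : ℝ, 0 < t → 0 < h t) {t p : ℝ}
    (ht : 0 < t) (hp : 0 < p) (hp1 : p ≤ 1) : h t ^ p ≤ h (t ^ p) := by
  have htp := Real.rpow_pos_of_pos ht p
  have h1 := hm (t ^ p) htp p⁻¹ ((one_le_inv₀ hp).2 hp1)
  rw [Real.rpow_rpow_inv ht.le hp.ne'] at h1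
  have h2 := Real.rpow_le_rpow (hpos _ ht).le h1 hp.le
  rwa [Real.rpow_inv_rpow (hpos _ htp).le hp.ne'] at h2

lemma div_rpow_mul_rpow_one_add {c y : ℝ} (hc : 0 < c) (hy : 0 < y) (s : ℝ) :
    (c / y) ^ s * y ^ (1 + s) = c ^ s * y := by
  have := (Real.rpow_pos_of_pos hy s).ne'
  rw [Real.div_rpow hc.le hy.le, Real.rpow_add hy, Real.rpow_one]
  field_simp

variable {H : Type u} [NormedAddCommGroup H] [InnerProductSpace ℂ H] [CompleteSpace H]

lemma rpow_neg_half_conj_mean (h : ℝ → ℝ) {A B : H →L[ℂ] H} (hA : IsStrictlyPositive A) :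
    A ^ (-(1 / 2) : ℝ) * operatorMean h A B * A ^ (-(1 / 2) : ℝ)
      = cfc h (A ^ (-(1 / 2) : ℝ) * B * A ^ (-(1 / 2) : ℝ)) := by
  rw [operatorMean_def]
  set M := cfc h (A ^ (-(1 / 2) : ℝ) * B * A ^ (-(1 / 2) : ℝ))
  calc _ = (A ^ (-(1 / 2) : ℝ) * A ^ (1 / 2 : ℝ)) * M
        * (A ^ (1 / 2 : ℝ) * A ^ (-(1 / 2) : ℝ)) := by simp only [mul_assoc]
    _ = M := by
      rw [CFC.rpow_neg_mul_rpow _ hA, CFC.rpow_mul_rpow_neg _ hA, one_mul, mul_one]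

lemma rpow_neg_half_conj_smul_one {A : H →L[ℂ] H} (hA : IsStrictlyPositive A) (c : ℝ) :
    A ^ (-(1 / 2) : ℝ) * (c • (1 : H →L[ℂ] H)) * A ^ (-(1 / 2) : ℝ) = c • A ^ (-1 : ℝ) := by
  rw [mul_smul_comm, mul_one, smul_mul_assoc, ← CFC.rpow_add hA.isUnit]
  norm_num

lemma cfc_div_const_rpow_neg_one {h : ℝ → ℝ} (hc : ContinuousOn h (Set.Ioi 0))
    (hpos : ∀ t : ℝ, 0 < t → 0 < h t) {X : H →L[ℂ] H} (hX : IsStrictlyPositive X) {c : ℝ}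
    (hc0 : 0 < c) : (c⁻¹ • cfc h X) ^ (-1 : ℝ) = cfc (fun t => c / h t) X := by
  have hhX := hX.continuousOn_spectrum hc
  rw [← cfc_const_mul c⁻¹ h X hhX, CFC.cfc_rpow
    (fun t ht => mul_pos (inv_pos.2 hc0) (hpos t (hX.spectrum_pos ht)))
    (continuousOn_const.mul hhX) hX.isSelfAdjoint]
  refine cfc_congr fun t ht => ?_
  simp only [Real.rpow_neg_one, mul_inv, inv_inv, div_eq_mul_inv]

lemma rpow_neg_one_rpow_neg_one {A : H →L[ℂ] H} (hA : IsStrictlyPositive A) :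
    (A ^ (-1 : ℝ)) ^ (-1 : ℝ) = A := by
  rw [hA.rpow_rpow]; norm_num; exact CFC.rpow_one A hA.nonneg

/-- Conjugating by A^{-1/2} turns the hypothesis into c A^{-1} ≤ h(X); dividing by c and inverting
gives the claim. -/
lemma cfc_const_div_le_of_smul_one_le_mean {h : ℝ → ℝ} (hc : ContinuousOn h (Set.Ioi 0))
    (hpos : ∀ t : ℝ, 0 < t → 0 < h t) {A B : H →L[ℂ] H} (hA : IsStrictlyPositive A)
    (hB : IsStrictlyPositive B) {c : ℝ} (hc0 : 0 < c) (hle : c • 1 ≤ operatorMean h A B) :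
    cfc (fun t => c / h t) (A ^ (-(1 / 2) : ℝ) * B * A ^ (-(1 / 2) : ℝ)) ≤ A := by
  have h1 := (rpow_isSelfAdjoint A (-(1 / 2))).conjugate_le_conjugate hle
  rw [rpow_neg_half_conj_mean h hA, rpow_neg_half_conj_smul_one hA] at h1
  have h2 := smul_le_smul_of_nonneg_left h1 (inv_pos.2 hc0).le
  rw [smul_smul, inv_mul_cancel₀ hc0.ne', one_smul] at h2
  have h3 := CStarAlgebra.rpow_neg_one_le_rpow_neg_one h2 (IsStrictlyPositive.rpow A (-1) hA)
  rwa [rpow_neg_one_rpow_neg_one hA,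
    cfc_div_const_rpow_neg_one hc hpos (hA.rpow_conj hB _) hc0] at h3

lemma le_cfc_const_div_of_mean_le_smul_one {h : ℝ → ℝ} (hc : ContinuousOn h (Set.Ioi 0))
    (hpos : ∀ t : ℝ, 0 < t → 0 < h t) {A B : H →L[ℂ] H} (hA : IsStrictlyPositive A)
    (hB : IsStrictlyPositive B) {c : ℝ} (hc0 : 0 < c) (hle : operatorMean h A B ≤ c • 1) :
    A ≤ cfc (fun t => c / h t) (A ^ (-(1 / 2) : ℝ) * B * A ^ (-(1 / 2) : ℝ)) := by
  have hX := hA.rpow_conj hB (-(1 / 2))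
  have h1 := (rpow_isSelfAdjoint A (-(1 / 2))).conjugate_le_conjugate hle
  rw [rpow_neg_half_conj_mean h hA, rpow_neg_half_conj_smul_one hA] at h1
  have h2 := smul_le_smul_of_nonneg_left h1 (inv_pos.2 hc0).le
  rw [smul_smul, inv_mul_cancel₀ hc0.ne', one_smul] at h2
  have h3 := CStarAlgebra.rpow_neg_one_le_rpow_neg_one h2
    ((hX.cfc_of_pos hc hpos).smul (inv_pos.2 hc0))
  rwa [rpow_neg_one_rpow_neg_one hA, cfc_div_const_rpow_neg_one hc hpos hX hc0] at h3

lemma smul_operatorMean {h : ℝ → ℝ} (hc : ContinuousOn h (Set.Ioi 0))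
    {A B : H →L[ℂ] H} (hA : IsStrictlyPositive A) (hB : IsStrictlyPositive B) (r : ℝ) :
    r • operatorMean h A B = A ^ (1 / 2 : ℝ) * cfc (fun t => r * h t)
      (A ^ (-(1 / 2) : ℝ) * B * A ^ (-(1 / 2) : ℝ)) * A ^ (1 / 2 : ℝ) := by
  rw [cfc_const_mul r h _ ((hA.rpow_conj hB _).continuousOn_spectrum hc), mul_smul_comm,
    smul_mul_assoc, operatorMean_def]

/-- Comparison of `A` with a function of `X = A^{-1/2} B A^{-1/2}` bounds the mean of powers
from below. -/
lemma smul_mean_le_mean_rpow {h : ℝ → ℝ} (hh : IsOperatorMonotone.{u} h)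
    (hpos : ∀ t : ℝ, 0 < t → 0 < h t) {A B X : H →L[ℂ] H} (hA : IsStrictlyPositive A)
    (hB : IsStrictlyPositive B) (hXdef : X = A ^ (-(1 / 2) : ℝ) * B * A ^ (-(1 / 2) : ℝ))
    {c s : ℝ} (hc0 : 0 < c)
    (h1 : cfc (fun t => c / h t) X ^ s ≤ A ^ s)
    (h2 : sandwichPow s X (cfc (fun t => c / h t) X) ≤ sandwichPow s X A)
    (hpow : ∀ t : ℝ, 0 < t → h t ^ (1 + s) ≤ h (t ^ (1 + s))) :
    c ^ s • operatorMean h A B ≤ operatorMean h (A ^ (1 + s)) (B ^ (1 + s)) := by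
  have hX : IsStrictlyPositive X := hXdef ▸ hA.rpow_conj hB _
  have hw : ContinuousOn (fun t => c / h t) (Set.Ioi 0) :=
    continuousOn_const.div hh.1 fun t ht => (hpos t ht).ne'
  have hw0 : ∀ t : ℝ, 0 < t → 0 < c / h t := fun t ht => div_pos hc0 (hpos t ht)
  have hW := hX.cfc_of_pos hw hw0
  have key := operatorMean_mono hh hpos (IsStrictlyPositive.rpow _ s hW)
    (isStrictlyPositive_sandwichPow s hX hW) h1 h2
  rw [operatorMean_cfc_rpow_sandwichPow hh.1 hw hw0 hX] at key
  rw [smul_operatorMean hh.1 hA hB, operatorMean_rpow_rpow h hA hB, ← hXdef]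
  -- After the outer A^{1/2} is stripped, both sides are functions of X, and only the scalar
  -- inequality c^s h(t) ≤ (c / h t)^s h(t^{1+s}) remains.
  refine (rpow_isSelfAdjoint A _).conjugate_le_conjugate (le_trans ?_ key)
  refine cfc_mono (fun t ht => ?_)
    (hX.continuousOn_spectrum (continuousOn_const.mul hh.1))
    (hX.continuousOn_spectrum ?_)
  · have ht0 := hX.spectrum_pos ht
    rw [← div_rpow_mul_rpow_one_add hc0 (hpos t ht0)]
    exact mul_le_mul_of_nonneg_left (hpow t ht0) (Real.rpow_nonneg (hw0 t ht0).le _)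
  · exact (hw.rpow_const fun t ht => Or.inl (hw0 t ht).ne').mul
      (hh.1.comp (continuousOn_rpow_Ioi _) fun t ht => Real.rpow_pos_of_pos ht _)

/-- Comparison of `A` with a function of `X = A^{-1/2} B A^{-1/2}` bounds the mean of powers
from above. -/
lemma mean_rpow_le_smul_mean {h : ℝ → ℝ} (hh : IsOperatorMonotone.{u} h)
    (hpos : ∀ t : ℝ, 0 < t → 0 < h t) {A B X : H →L[ℂ] H} (hA : IsStrictlyPositive A)
    (hB : IsStrictlyPositive B) (hXdef : X = A ^ (-(1 / 2) : ℝ) * B * A ^ (-(1 / 2) : ℝ))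
    {c s : ℝ} (hc0 : 0 < c)
    (h1 : A ^ s ≤ cfc (fun t => c / h t) X ^ s)
    (h2 : sandwichPow s X A ≤ sandwichPow s X (cfc (fun t => c / h t) X))
    (hpow : ∀ t : ℝ, 0 < t → h (t ^ (1 + s)) ≤ h t ^ (1 + s)) :
    operatorMean h (A ^ (1 + s)) (B ^ (1 + s)) ≤ c ^ s • operatorMean h A B := by
  have hX : IsStrictlyPositive X := hXdef ▸ hA.rpow_conj hB _
  have hw : ContinuousOn (fun t => c / h t) (Set.Ioi 0) :=
    continuousOn_const.div hh.1 fun t ht => (hpos t ht).ne'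
  have hw0 : ∀ t : ℝ, 0 < t → 0 < c / h t := fun t ht => div_pos hc0 (hpos t ht)
  have key := operatorMean_mono hh hpos (IsStrictlyPositive.rpow _ s hA)
    (isStrictlyPositive_sandwichPow s hX hA) h1 h2
  rw [operatorMean_cfc_rpow_sandwichPow hh.1 hw hw0 hX] at key
  rw [smul_operatorMean hh.1 hA hB, operatorMean_rpow_rpow h hA hB, ← hXdef]
  refine (rpow_isSelfAdjoint A _).conjugate_le_conjugate (key.trans ?_)
  refine cfc_mono (fun t ht => ?_) (hX.continuousOn_spectrum ?_)
    (hX.continuousOn_spectrum (continuousOn_const.mul hh.1))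
  · have ht0 := hX.spectrum_pos ht
    rw [← div_rpow_mul_rpow_one_add hc0 (hpos t ht0)]
    exact mul_le_mul_of_nonneg_left (hpow t ht0) (Real.rpow_nonneg (hw0 t ht0).le _)
  · exact (hw.rpow_const fun t ht => Or.inl (hw0 t ht).ne').mul
      (hh.1.comp (continuousOn_rpow_Ioi _) fun t ht => Real.rpow_pos_of_pos ht _)

lemma sq_rpow_sub_one_mul {c : ℝ} (hc : 0 < c) (p : ℝ) :
    (c * c) ^ (p / 2 - 1) * c = c ^ (p - 1) := by
  have e : p - 1 = (p / 2 - 1) + (p / 2 - 1) + 1 := by ring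
  rw [e, Real.rpow_add hc, Real.rpow_add hc, Real.rpow_one, Real.mul_rpow hc.le hc.le]

variable {h : ℝ → ℝ} (hh : IsOperatorMonotone.{u} h) (hpos : ∀ t : ℝ, 0 < t → 0 < h t)

include hh hpos

/-- The restriction p ≤ 2 is what Löwner-Heinz requires of the exponent p - 1. -/
lemma IsPMI.smul_mean_le_of_le_two (hm : IsPMI h) {A B : H →L[ℂ] H} (hA : IsStrictlyPositive A)
    (hB : IsStrictlyPositive B) {c p : ℝ} (hc0 : 0 < c) (hle : c • 1 ≤ operatorMean h A B)
    (hp1 : 1 ≤ p) (hp2 : p ≤ 2) :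
    c ^ (p - 1) • operatorMean h A B ≤ operatorMean h (A ^ p) (B ^ p) := by
  have hW := cfc_const_div_le_of_smul_one_le_mean hh.1 hpos hA hB hc0 hle
  have hs : p - 1 ∈ Set.Icc (0 : ℝ) 1 := ⟨by linarith, by linarith⟩
  have := smul_mean_le_mean_rpow hh hpos hA hB rfl hc0 (CFC.rpow_le_rpow hs hW)
    (sandwichPow_mono hs _ hW) (fun t ht => hm t ht _ (by linarith [hs.1]))
  rwa [add_sub_cancel] at this

/-- Now p - 1 lies in [-1, 0], so both arguments of the mean are antitone in A and W ≤ A yields an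
upper bound. -/
lemma IsPMI.mean_rpow_le_smul_mean (hm : IsPMI h) {A B : H →L[ℂ] H} (hA : IsStrictlyPositive A)
    (hB : IsStrictlyPositive B) {c p : ℝ} (hc0 : 0 < c) (hle : c • 1 ≤ operatorMean h A B)
    (hp0 : 0 < p) (hp1 : p ≤ 1) :
    operatorMean h (A ^ p) (B ^ p) ≤ c ^ (p - 1) • operatorMean h A B := by
  have hW := cfc_const_div_le_of_smul_one_le_mean hh.1 hpos hA hB hc0 hle
  have hX := hA.rpow_conj hB (-(1 / 2))
  have hWpos := hX.cfc_of_pos (f := fun t => c / h t)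
    (continuousOn_const.div hh.1 fun t ht => (hpos t ht).ne')
    fun t ht => div_pos hc0 (hpos t ht)
  have hs : p - 1 ∈ Set.Icc (-1 : ℝ) 0 := ⟨by linarith, by linarith⟩
  have := _root_.mean_rpow_le_smul_mean hh hpos hA hB rfl hc0 (rpow_le_rpow_of_nonpos hWpos hW hs)
    (sandwichPow_anti hs hX hWpos hW)
    (fun t ht => hm.le_rpow hpos ht (by linarith) (by linarith))
  rwa [add_sub_cancel] at this

lemma IsPMD.mean_rpow_le_of_le_two (hm : IsPMD h) {A B : H →L[ℂ] H} (hA : IsStrictlyPositive A)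
    (hB : IsStrictlyPositive B) {c p : ℝ} (hc0 : 0 < c) (hle : operatorMean h A B ≤ c • 1)
    (hp1 : 1 ≤ p) (hp2 : p ≤ 2) :
    operatorMean h (A ^ p) (B ^ p) ≤ c ^ (p - 1) • operatorMean h A B := by
  have hW := le_cfc_const_div_of_mean_le_smul_one hh.1 hpos hA hB hc0 hle
  have hs : p - 1 ∈ Set.Icc (0 : ℝ) 1 := ⟨by linarith, by linarith⟩
  have := _root_.mean_rpow_le_smul_mean hh hpos hA hB rfl hc0 (CFC.rpow_le_rpow hs hW)
    (sandwichPow_mono hs _ hW) (fun t ht => hm t ht _ (by linarith [hs.1]))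
  rwa [add_sub_cancel] at this

lemma IsPMD.smul_mean_le_mean_rpow (hm : IsPMD h) {A B : H →L[ℂ] H} (hA : IsStrictlyPositive A)
    (hB : IsStrictlyPositive B) {c p : ℝ} (hc0 : 0 < c) (hle : operatorMean h A B ≤ c • 1)
    (hp0 : 0 < p) (hp1 : p ≤ 1) :
    c ^ (p - 1) • operatorMean h A B ≤ operatorMean h (A ^ p) (B ^ p) := by
  have hW := le_cfc_const_div_of_mean_le_smul_one hh.1 hpos hA hB hc0 hle
  have hX := hA.rpow_conj hB (-(1 / 2))
  have hs : p - 1 ∈ Set.Icc (-1 : ℝ) 0 := ⟨by linarith, by linarith⟩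
  have := _root_.smul_mean_le_mean_rpow hh hpos hA hB rfl hc0 (rpow_le_rpow_of_nonpos hA hW hs)
    (sandwichPow_anti hs hX hA hW)
    (fun t ht => hm.rpow_le hpos ht (by linarith) (by linarith))
  rwa [add_sub_cancel] at this

lemma IsPMI.smul_mean_le_of_le_two_pow (hm : IsPMI h) (n : ℕ) {A B : H →L[ℂ] H}
    (hA : IsStrictlyPositive A) (hB : IsStrictlyPositive B) {c p : ℝ} (hc0 : 0 < c)
    (hle : c • 1 ≤ operatorMean h A B) (hp1 : 1 ≤ p) (hpn : p ≤ 2 ^ n) :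
    c ^ (p - 1) • operatorMean h A B ≤ operatorMean h (A ^ p) (B ^ p) := by
  induction n generalizing A B c p with
  | zero =>
    rw [pow_zero] at hpn
    exact hm.smul_mean_le_of_le_two hh hpos hA hB hc0 hle hp1 (by linarith)
  | succ n ih =>
    rcases le_total p 2 with hp2 | hp2
    · exact hm.smul_mean_le_of_le_two hh hpos hA hB hc0 hle hp1 hp2
    have h2 := hm.smul_mean_le_of_le_two hh hpos hA hB hc0 hle one_le_two le_rfl
    rw [show (2 - 1 : ℝ) = 1 by norm_num, Real.rpow_one] at h2
    -- The case p = 2 reproduces the hypothesis for A², B² with constant c², so the induction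
    -- applies with exponent p / 2.
    have hcc : (c * c) • (1 : H →L[ℂ] H) ≤ operatorMean h (A ^ (2 : ℝ)) (B ^ (2 : ℝ)) := by
      rw [mul_smul]
      exact (smul_le_smul_of_nonneg_left hle hc0.le).trans h2
    have key := ih (IsStrictlyPositive.rpow A 2 hA) (IsStrictlyPositive.rpow B 2 hB)
      (mul_pos hc0 hc0) hcc (p := p / 2) (by linarith) (by rw [pow_succ] at hpn; linarith)
    rw [hA.rpow_rpow, hB.rpow_rpow, mul_div_cancel₀ p two_ne_zero] at key
    refine le_trans ?_ key
    rw [← sq_rpow_sub_one_mul hc0, mul_smul]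
    exact smul_le_smul_of_nonneg_left h2 (Real.rpow_nonneg (mul_pos hc0 hc0).le _)

lemma IsPMD.mean_rpow_le_of_le_two_pow (hm : IsPMD h) (n : ℕ) {A B : H →L[ℂ] H}
    (hA : IsStrictlyPositive A) (hB : IsStrictlyPositive B) {c p : ℝ} (hc0 : 0 < c)
    (hle : operatorMean h A B ≤ c • 1) (hp1 : 1 ≤ p) (hpn : p ≤ 2 ^ n) :
    operatorMean h (A ^ p) (B ^ p) ≤ c ^ (p - 1) • operatorMean h A B := by
  induction n generalizing A B c p with
  | zero =>
    rw [pow_zero] at hpn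
    exact hm.mean_rpow_le_of_le_two hh hpos hA hB hc0 hle hp1 (by linarith)
  | succ n ih =>
    rcases le_total p 2 with hp2 | hp2
    · exact hm.mean_rpow_le_of_le_two hh hpos hA hB hc0 hle hp1 hp2
    have h2 := hm.mean_rpow_le_of_le_two hh hpos hA hB hc0 hle one_le_two le_rfl
    rw [show (2 - 1 : ℝ) = 1 by norm_num, Real.rpow_one] at h2
    have hcc : operatorMean h (A ^ (2 : ℝ)) (B ^ (2 : ℝ)) ≤ (c * c) • (1 : H →L[ℂ] H) := by
      rw [mul_smul]
      exact h2.trans (smul_le_smul_of_nonneg_left hle hc0.le)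
    have key := ih (IsStrictlyPositive.rpow A 2 hA) (IsStrictlyPositive.rpow B 2 hB)
      (mul_pos hc0 hc0) hcc (p := p / 2) (by linarith) (by rw [pow_succ] at hpn; linarith)
    rw [hA.rpow_rpow, hB.rpow_rpow, mul_div_cancel₀ p two_ne_zero] at key
    refine key.trans ?_
    rw [← sq_rpow_sub_one_mul hc0, mul_smul]
    exact smul_le_smul_of_nonneg_left h2 (Real.rpow_nonneg (mul_pos hc0 hc0).le _)

end AndoHiai

/-! ### Spectral bounds and conclusion. -/

section Spectrum

variable {H : Type u} [NormedAddCommGroup H] [InnerProductSpace ℂ H] [CompleteSpace H]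

lemma lambdaMin_smul_one_le {X : H →L[ℂ] H} (hX : IsSelfAdjoint X) :
    lambdaMin X • (1 : H →L[ℂ] H) ≤ X := by
  rw [← Algebra.algebraMap_eq_smul_one, algebraMap_le_iff_le_spectrum hX]
  exact fun x hx => csInf_le (spectrum.isBounded (𝕜 := ℝ) X).bddBelow hx

lemma lambdaMin_pos [Nontrivial H] {X : H →L[ℂ] H} (hX : IsStrictlyPositive X) :
    0 < lambdaMin X :=
  hX.spectrum_pos ((spectrum.isCompact (𝕜 := ℝ) X).sInf_mem
    (ContinuousFunctionalCalculus.spectrum_nonempty X hX.isSelfAdjoint))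

end Spectrum

theorem corollary3p3 {H : Type u} [NormedAddCommGroup H] [InnerProductSpace ℂ H]
    [CompleteSpace H] (h : ℝ → ℝ) (hh : h ∈ OMPlusOne.{u}) (A B : H →L[ℂ] H)
    (hA : IsStrictlyPositive A) (hB : IsStrictlyPositive B) :
    (IsPMI h →
      (∀ p : ℝ, 1 ≤ p →
        lambdaMin (operatorMean h A B) ^ (p - 1) • operatorMean h A B
          ≤ operatorMean h (A ^ p) (B ^ p)) ∧
      (∀ p : ℝ, 0 < p → p ≤ 1 →
        operatorMean h (A ^ p) (B ^ p)
          ≤ lambdaMin (operatorMean h A B) ^ (p - 1) • operatorMean h A B)) ∧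
    (IsPMD h →
      (∀ p : ℝ, 1 ≤ p →
        operatorMean h (A ^ p) (B ^ p)
          ≤ ‖operatorMean h A B‖ ^ (p - 1) • operatorMean h A B) ∧
      (∀ p : ℝ, 0 < p → p ≤ 1 →
        ‖operatorMean h A B‖ ^ (p - 1) • operatorMean h A B
          ≤ operatorMean h (A ^ p) (B ^ p))) := by
  obtain ⟨hop, hpos, -⟩ := hh
  cases subsingleton_or_nontrivial H with
  -- On the zero space the spectrum is empty and `lambdaMin` is not positive, so this case is split
  -- off.
  | inl _ =>
    exact ⟨fun _ => ⟨fun _ _ => (Subsingleton.elim _ _).le,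
      fun _ _ _ => (Subsingleton.elim _ _).le⟩,
      fun _ => ⟨fun _ _ => (Subsingleton.elim _ _).le, fun _ _ _ => (Subsingleton.elim _ _).le⟩⟩
  | inr _ =>
  have hM := isStrictlyPositive_operatorMean hop.1 hpos hA hB
  have hlow := lambdaMin_smul_one_le hM.isSelfAdjoint
  have hlow0 := lambdaMin_pos hM
  have hup : operatorMean h A B ≤ ‖operatorMean h A B‖ • 1 := by
    rw [← Algebra.algebraMap_eq_smul_one]
    exact hM.isSelfAdjoint.le_algebraMap_norm_self
  have hup0 : 0 < ‖operatorMean h A B‖ := norm_pos_iff.2 hM.isUnit.ne_zero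
  refine ⟨fun hm => ⟨fun p hp => ?_, fun p hp0 hp1 => ?_⟩,
    fun hm => ⟨fun p hp => ?_, fun p hp0 hp1 => ?_⟩⟩
  · obtain ⟨n, hn⟩ := pow_unbounded_of_one_lt p one_lt_two
    exact hm.smul_mean_le_of_le_two_pow hop hpos n hA hB hlow0 hlow hp hn.le
  · exact hm.mean_rpow_le_smul_mean hop hpos hA hB hlow0 hlow hp0 hp1
  · obtain ⟨n, hn⟩ := pow_unbounded_of_one_lt p one_lt_two
    exact hm.mean_rpow_le_of_le_two_pow hop hpos n hA hB hup0 hup hp hn.le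
  · exact hm.smul_mean_le_mean_rpow hop hpos hA hB hup0 hup hp0 hp1
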